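/- Let $\Gamma=\langle x,y \mid y^{-1}x^2y=x^{-2},\ x^{-1}y^2x=y^{-2}\rangle$ be the (Passman) fours group, and write $a=x^2$, $b=y^2$, $c=(xy)^2$. Let $P\subset\Gamma$ be the Promislow set $$P = Ax\cup By\cup C,$$ where $$A=\{1,a^{-1},a^{-1}b,b,a^{-1}c^{-1},c\},\quad B=\{1,a,b^{-1},b^{-1}c,c,ab^{-1}c\},\quad C=\{c,c^{-1}\}.$$ Then for every field $K$, no unit of the group algebra $K\Gamma$ has support equal to $P$. -/

import Mathlib

/-- The relators `y⁻¹x²y · x²` and `x⁻¹y²x · y²` in the free group on `x = of 0`, `y = of 1`;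
they express the relations `y⁻¹x²y = x⁻²` and `x⁻¹y²x = y⁻²`. -/
def foursRels : Set (FreeGroup (Fin 2)) :=
  {(FreeGroup.of 1)⁻¹ * FreeGroup.of 0 ^ 2 * FreeGroup.of 1 * FreeGroup.of 0 ^ 2,
   (FreeGroup.of 0)⁻¹ * FreeGroup.of 1 ^ 2 * FreeGroup.of 0 * FreeGroup.of 1 ^ 2}

/-- The (Passman) fours group `Γ = ⟨x, y ∣ y⁻¹x²y = x⁻², x⁻¹y²x = y⁻²⟩`. -/
abbrev FoursGroup : Type := PresentedGroup foursRels

namespace FoursGroup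

/-- The generator `x` of `Γ`. -/
def x : FoursGroup := PresentedGroup.of 0

/-- The generator `y` of `Γ`. -/
def y : FoursGroup := PresentedGroup.of 1

/-- `a = x²`. -/
def a : FoursGroup := x ^ 2

/-- `b = y²`. -/
def b : FoursGroup := y ^ 2

/-- `c = (xy)²`. -/
def c : FoursGroup := (x * y) ^ 2

/-- `A = {1, a⁻¹, a⁻¹b, b, a⁻¹c⁻¹, c}`. -/
def setA : Set FoursGroup := {1, a⁻¹, a⁻¹ * b, b, a⁻¹ * c⁻¹, c}

/-- `B = {1, a, b⁻¹, b⁻¹c, c, ab⁻¹c}`. -/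
def setB : Set FoursGroup := {1, a, b⁻¹, b⁻¹ * c, c, a * b⁻¹ * c}

/-- `C = {c, c⁻¹}`. -/
def setC : Set FoursGroup := {c, c⁻¹}

/-- The Promislow set `P = Ax ∪ By ∪ C`. -/
def promislowSet : Set FoursGroup :=
  (fun g => g * x) '' setA ∪ (fun g => g * y) '' setB ∪ setC

end FoursGroup

/-! A unit would map to an invertible matrix under every 4-dimensional representation `rep a b c`,
so it suffices to find one whose image of `σ` is singular. Over an algebraically closed `L`, fix `b`
and `c`: the determinant times `a ^ 2` is a quartic in `a`, and it has a nonzero root once its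
extreme coefficients are nonzero (`exists_ne_zero_quartic_eq_zero`). These are products of values of
`topPart` at `(b^±1, c^±1)`; the trivial coset affects only the middle coefficients. Take `b = t`,
`c = t ^ 3` with `t` transcendental over `K`. If `topPart` vanished there, its monomial coefficients
would all vanish, which `topPart_coeffs_incompatible` excludes when every coefficient of `σ` on the
support is nonzero. -/

open Matrix Polynomial

namespace FoursGroup

/-! ### The induced representation and the image of an element supported on the Promislow set -/

section Representation

variable {L : Type*} [Field L]

/-- The matrix of right multiplication by `x` in the basis `1, x, y, xy` of the group algebra over
`⟨a, b, c⟩`, evaluated at the point `(a, b, c)` of the torus. -/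
def matX (a b c : Lˣ) : Matrix (Fin 4) (Fin 4) L :=
  !![0, 1, 0, 0; (a : L), 0, 0, 0; 0, 0, 0, (a : L)⁻¹ * b * (c : L)⁻¹; 0, 0, (b : L)⁻¹ * c, 0]

/-- The inverse of `matX a b c`. -/
def matXInv (a b c : Lˣ) : Matrix (Fin 4) (Fin 4) L :=
  !![0, (a : L)⁻¹, 0, 0; 1, 0, 0, 0; 0, 0, 0, b * (c : L)⁻¹; 0, 0, a * (b : L)⁻¹ * c, 0]

/-- The matrix of right multiplication by `y`; see `matX`. -/
def matY (b : Lˣ) : Matrix (Fin 4) (Fin 4) L :=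
  !![0, 0, 1, 0; 0, 0, 0, 1; (b : L), 0, 0, 0; 0, (b : L)⁻¹, 0, 0]

/-- The inverse of `matY b`. -/
def matYInv (b : Lˣ) : Matrix (Fin 4) (Fin 4) L :=
  !![0, 0, (b : L)⁻¹, 0; 0, 0, 0, (b : L); 1, 0, 0, 0; 0, 1, 0, 0]

theorem matX_mul_inv (a b c : Lˣ) : matX a b c * matXInv a b c = 1 := by
  ext i j
  fin_cases i <;> fin_cases j <;> simp [matX, matXInv, Matrix.mul_apply, Fin.sum_univ_four] <;>
    field_simp

theorem matY_mul_inv (b : Lˣ) : matY b * matYInv b = 1 := by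
  ext i j
  fin_cases i <;> fin_cases j <;> simp [matY, matYInv, Matrix.mul_apply, Fin.sum_univ_four]

/-- `matX a b c` as an invertible matrix. -/
def unitX (a b c : Lˣ) : (Matrix (Fin 4) (Fin 4) L)ˣ :=
  ⟨matX a b c, matXInv a b c, matX_mul_inv a b c, mul_eq_one_comm.mp (matX_mul_inv a b c)⟩

/-- `matY b` as an invertible matrix. -/
def unitY (b : Lˣ) : (Matrix (Fin 4) (Fin 4) L)ˣ :=
  ⟨matY b, matYInv b, matY_mul_inv b, mul_eq_one_comm.mp (matY_mul_inv b)⟩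

/-- Invertible diagonal matrices. -/
def unitDiag (d : Fin 4 → Lˣ) : (Matrix (Fin 4) (Fin 4) L)ˣ :=
  ⟨diagonal fun i => (d i : L), diagonal fun i => (d i : L)⁻¹, by simp, by simp⟩

theorem unitX_sq (a b c : Lˣ) : unitX a b c ^ 2 = unitDiag ![a, a, a⁻¹, a⁻¹] := by
  ext i j
  fin_cases i <;> fin_cases j <;>
    simp [pow_two, unitX, matX, unitDiag, Matrix.mul_apply, Fin.sum_univ_four] <;> field_simp

theorem unitY_sq (b : Lˣ) : unitY b ^ 2 = unitDiag ![b, b⁻¹, b, b⁻¹] := by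
  ext i j
  fin_cases i <;> fin_cases j <;>
    simp [pow_two, unitY, matY, unitDiag, Matrix.mul_apply, Fin.sum_univ_four]

theorem unitX_mul_unitY_sq (a b c : Lˣ) :
    (unitX a b c * unitY b) ^ 2 = unitDiag ![c, c⁻¹, c⁻¹, c] := by
  have h : ((unitX a b c * unitY b : (Matrix (Fin 4) (Fin 4) L)ˣ) : Matrix (Fin 4) (Fin 4) L) =
      !![0, 0, 0, 1; 0, 0, (a : L), 0; 0, (a : L)⁻¹ * (c : L)⁻¹, 0, 0; (c : L), 0, 0, 0] := by
    ext i j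
    fin_cases i <;> fin_cases j <;>
      simp [unitX, matX, unitY, matY, Matrix.mul_apply, Fin.sum_univ_four] <;> field_simp
  rw [pow_two, Units.ext_iff, Units.val_mul, h]
  ext i j
  fin_cases i <;> fin_cases j <;>
    simp [unitDiag, Matrix.mul_apply, Fin.sum_univ_four, mul_right_comm]

/-- The four-dimensional representation of the fours group, induced from the character `(a, b, c)` of
its maximal abelian normal subgroup. -/
def rep (a b c : Lˣ) : FoursGroup →* (Matrix (Fin 4) (Fin 4) L)ˣ :=
  PresentedGroup.toGroup (f := ![unitX a b c, unitY b]) <| by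
    rintro r (rfl | rfl)
    · simp only [map_mul, map_inv, map_pow, FreeGroup.lift_apply_of, Matrix.cons_val_zero,
        Matrix.cons_val_one, unitX_sq]
      rw [mul_assoc, mul_assoc, inv_mul_eq_one]
      ext i j
      fin_cases i <;> fin_cases j <;>
        simp [unitY, matY, unitDiag, vecMul_diagonal, mul_comm]
    · simp only [map_mul, map_inv, map_pow, FreeGroup.lift_apply_of, Matrix.cons_val_zero,
        Matrix.cons_val_one, unitY_sq]
      rw [mul_assoc, mul_assoc, inv_mul_eq_one]
      ext i j
      fin_cases i <;> fin_cases j <;>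
        simp [unitX, matX, unitDiag, vecMul_diagonal, mul_comm]

theorem rep_x (a b c : Lˣ) : rep a b c FoursGroup.x = unitX a b c := by
  simp [rep, FoursGroup.x]

theorem rep_y (a b c : Lˣ) : rep a b c FoursGroup.y = unitY b := by
  simp [rep, FoursGroup.y]

theorem rep_a (a b c : Lˣ) : rep a b c FoursGroup.a = unitDiag ![a, a, a⁻¹, a⁻¹] := by
  rw [FoursGroup.a, map_pow, rep_x, unitX_sq]

theorem rep_b (a b c : Lˣ) : rep a b c FoursGroup.b = unitDiag ![b, b⁻¹, b, b⁻¹] := by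
  rw [FoursGroup.b, map_pow, rep_y, unitY_sq]

theorem rep_c (a b c : Lˣ) : rep a b c FoursGroup.c = unitDiag ![c, c⁻¹, c⁻¹, c] := by
  rw [FoursGroup.c, map_pow, map_mul, rep_x, rep_y, unitX_mul_unitY_sq]

/-- An enumeration of the Promislow set. -/
def promislowEnum : Fin 14 → FoursGroup :=
  ![1 * x, FoursGroup.a⁻¹ * x, FoursGroup.a⁻¹ * FoursGroup.b * x, FoursGroup.b * x,
    FoursGroup.a⁻¹ * FoursGroup.c⁻¹ * x, FoursGroup.c * x,
    1 * y, FoursGroup.a * y, FoursGroup.b⁻¹ * y, FoursGroup.b⁻¹ * FoursGroup.c * y,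
    FoursGroup.c * y, FoursGroup.a * FoursGroup.b⁻¹ * FoursGroup.c * y,
    FoursGroup.c, FoursGroup.c⁻¹]

theorem range_promislowEnum : Set.range promislowEnum = promislowSet := by
  ext g
  simp only [Set.mem_range, Fin.exists_fin_succ, promislowSet, setA, setB, setC, Set.mem_union,
    Set.mem_image, Set.mem_insert_iff, Set.mem_singleton_iff, promislowEnum]
  simp [eq_comm, or_assoc]

/-- The first rows of the images under `rep` of the elements of the Promislow set. -/
def rowEnum (a b c : L) : Fin 14 → Fin 4 → L :=
  ![![0, 1, 0, 0], ![0, a⁻¹, 0, 0], ![0, a⁻¹ * b, 0, 0], ![0, b, 0, 0], ![0, a⁻¹ * c⁻¹, 0, 0],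
    ![0, c, 0, 0],
    ![0, 0, 1, 0], ![0, 0, a, 0], ![0, 0, b⁻¹, 0], ![0, 0, b⁻¹ * c, 0], ![0, 0, c, 0],
    ![0, 0, a * b⁻¹ * c, 0], ![c, 0, 0, 0], ![c⁻¹, 0, 0, 0]]

theorem rep_promislowEnum_row (a b c : Lˣ) (i : Fin 14) :
    (rep a b c (promislowEnum i) : Matrix (Fin 4) (Fin 4) L) 0 = rowEnum (a : L) b c i := by
  ext j
  fin_cases i <;> fin_cases j <;>
  simp [promislowEnum, rep_x, rep_y, rep_a, rep_b, rep_c, rowEnum,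
    unitDiag, unitX, unitY, matX, matY]

theorem promislowEnum_injective : Function.Injective promislowEnum := by
  -- At the multiplicatively independent values 2, 3, 5, distinct monomials in `a, b, c` stay
  -- distinct, so first rows already separate the elements.
  let a : ℚˣ := Units.mk0 2 (by norm_num)
  let b : ℚˣ := Units.mk0 3 (by norm_num)
  let c : ℚˣ := Units.mk0 5 (by norm_num)
  have h : Function.Injective (rowEnum (2 : ℚ) 3 5) := by decide +kernel
  intro i j hij
  apply h
  have := rep_promislowEnum_row a b c
  simp only [a, b, c, Units.val_mk0] at this
  rw [← this, ← this, hij]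


/-- The part of `α` of degree `0` in `a`, where `α x` is the component of the element of the group
algebra with coefficients `s` along the Promislow set in the coset of `x`. -/
def alphaZero (s : Fin 14 → L) (b c : L) : L := s 0 + s 3 * b + s 5 * c

/-- The part of `α` of degree `-1` in `a`; see `alphaZero`. -/
def alphaOne (s : Fin 14 → L) (b c : L) : L := s 1 + s 2 * b + s 4 * c⁻¹

/-- The part of degree `0` in `a` of the component `β y` in the coset of `y`. -/
def betaZero (s : Fin 14 → L) (b c : L) : L := s 6 + s 8 * b⁻¹ + s 9 * (b⁻¹ * c) + s 10 * c

/-- The part of `β` of degree `1` in `a`; see `betaZero`. -/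
def betaOne (s : Fin 14 → L) (b c : L) : L := s 7 + s 11 * (b⁻¹ * c)

/-- The component in the trivial coset. -/
def gammaPart (s : Fin 14 → L) (c : L) : L := s 12 * c + s 13 * c⁻¹

theorem sum_rep_promislowEnum (a b c : Lˣ) (s : Fin 14 → L) :
    ∑ i, s i • (rep a b c (promislowEnum i) : Matrix (Fin 4) (Fin 4) L) =
      !![gammaPart s c, alphaZero s b c + alphaOne s b c * (a : L)⁻¹,
          betaZero s b c + betaOne s b c * a, 0;
        (alphaZero s (b : L)⁻¹ (c : L)⁻¹ + alphaOne s (b : L)⁻¹ (c : L)⁻¹ * (a : L)⁻¹) * a,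
          gammaPart s (c : L)⁻¹, 0,
          betaZero s (b : L)⁻¹ (c : L)⁻¹ + betaOne s (b : L)⁻¹ (c : L)⁻¹ * a;
        (betaZero s b (c : L)⁻¹ + betaOne s b (c : L)⁻¹ * (a : L)⁻¹) * b, 0,
          gammaPart s (c : L)⁻¹,
          (alphaZero s b (c : L)⁻¹ + alphaOne s b (c : L)⁻¹ * a) * ((a : L)⁻¹ * b * (c : L)⁻¹);
        0, (betaZero s (b : L)⁻¹ c + betaOne s (b : L)⁻¹ c * (a : L)⁻¹) * (b : L)⁻¹,
          (alphaZero s (b : L)⁻¹ c + alphaOne s (b : L)⁻¹ c * a) * ((b : L)⁻¹ * c),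
          gammaPart s c] := by
  ext i j
  rw [Matrix.sum_apply]
  fin_cases i <;> fin_cases j <;>
  simp [promislowEnum, rep_x, rep_y, rep_a, rep_b, rep_c, Fin.sum_univ_succ,
    unitDiag, unitX, unitY, matX, matY, alphaZero, alphaOne, betaZero, betaOne, gammaPart] <;>
  field_simp <;> ring

end Representation

/-! ### The determinant as a quartic in `a` -/

section Determinant

variable {L : Type*} [Field L]

theorem det_cyclic_pattern (g g' α β p q r s t u : L) :
    (!![g, α, β, 0; p, g', 0, q; r, 0, g', s; 0, t, u, g]).det =
      (g * g') ^ 2 - g * g' * (α * p + β * r + q * t + s * u) +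
        (α * u - β * t) * (p * s - q * r) := by
  simp [Matrix.det_succ_row_zero, Fin.sum_univ_succ, Fin.succAbove]
  ring

/-- The terms containing `g` contribute only in degrees 1 to 3, so the constant and leading
coefficients are `u₀ * v₀` and `u₂ * v₂`. The latter gives a root, the former keeps it away from 0.
-/
theorem exists_ne_zero_quartic_eq_zero [IsAlgClosed L] (g u₀ u₁ u₂ v₀ v₁ v₂ w₀ w₁ w₂ : L)
    (h₀ : u₀ * v₀ ≠ 0) (h₂ : u₂ * v₂ ≠ 0) :
    ∃ a : L, a ≠ 0 ∧ g ^ 2 * a ^ 2 - g * a * (w₂ * a ^ 2 + w₁ * a + w₀) +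
      (u₂ * a ^ 2 + u₁ * a + u₀) * (v₂ * a ^ 2 + v₁ * a + v₀) = 0 := by
  let f : L[X] := C (u₂ * v₂) * X ^ 4 + C (u₂ * v₁ + u₁ * v₂ - g * w₂) * X ^ 3 +
    C (u₂ * v₀ + u₁ * v₁ + u₀ * v₂ - g * w₁ + g ^ 2) * X ^ 2 +
    C (u₁ * v₀ + u₀ * v₁ - g * w₀) * X + C (u₀ * v₀)
  have hf : f.natDegree = 4 := by
    simp only [f]
    compute_degree!
    simpa using h₂
  obtain ⟨a, ha⟩ := IsAlgClosed.exists_root f fun h => by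
    simp [natDegree_eq_of_degree_eq_some h] at hf
  simp only [IsRoot, f, eval_add, eval_mul, eval_C, eval_pow, eval_X] at ha
  refine ⟨a, ?_, by linear_combination ha⟩
  rintro rfl
  apply h₀
  linear_combination ha

/-- The coefficient of `a` in `c α αᶻ - β βᶻ`. -/
def topPart (s : Fin 14 → L) (b c : L) : L :=
  c * alphaZero s b c * alphaOne s b⁻¹ c - betaOne s b c * betaZero s b⁻¹ c

theorem exists_det_sum_rep_eq_zero [IsAlgClosed L] (s : Fin 14 → L) (b c : Lˣ)
    (h₁ : topPart s b c ≠ 0) (h₂ : topPart s (b : L)⁻¹ c ≠ 0)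
    (h₃ : topPart s b (c : L)⁻¹ ≠ 0) (h₄ : topPart s (b : L)⁻¹ (c : L)⁻¹ ≠ 0) :
    ∃ a : Lˣ,
      (∑ i, s i • (rep a b c (promislowEnum i) : Matrix (Fin 4) (Fin 4) L)).det = 0 := by
  simp only [sum_rep_promislowEnum, det_cyclic_pattern]
  simp only [topPart, inv_inv] at h₁ h₂ h₃ h₄
  have hb : (b : L) ≠ 0 := b.ne_zero
  have hc : (c : L) ≠ 0 := c.ne_zero
  generalize (b : L) = b at *
  generalize (c : L) = c at *
  generalize gammaPart s c = g, gammaPart s c⁻¹ = g'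
  generalize alphaZero s b c = p₀, alphaOne s b c = p₁, betaZero s b c = q₀,
    betaOne s b c = q₁, alphaZero s b⁻¹ c⁻¹ = px₀, alphaOne s b⁻¹ c⁻¹ = px₁,
    betaZero s b⁻¹ c⁻¹ = qx₀, betaOne s b⁻¹ c⁻¹ = qx₁, alphaZero s b c⁻¹ = py₀,
    alphaOne s b c⁻¹ = py₁, betaZero s b c⁻¹ = qy₀, betaOne s b c⁻¹ = qy₁,
    alphaZero s b⁻¹ c = pz₀, alphaOne s b⁻¹ c = pz₁, betaZero s b⁻¹ c = qz₀,
    betaOne s b⁻¹ c = qz₁ at *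
  -- The quadratics `u` and `v` are `a` times `c α αᶻ - β βᶻ` and its conjugate by `x`; `w` collects
  -- the four products multiplying `g * g'`.
  obtain ⟨a, ha, h⟩ := exists_ne_zero_quartic_eq_zero (g * g')
    (c * pz₀ * p₁ - qz₁ * q₀) (c * (p₀ * pz₀ + p₁ * pz₁) - (q₀ * qz₀ + q₁ * qz₁))
    (c * p₀ * pz₁ - q₁ * qz₀)
    (c⁻¹ * py₀ * px₁ - qy₁ * qx₀) (c⁻¹ * (px₀ * py₀ + px₁ * py₁) - (qx₀ * qy₀ + qx₁ * qy₁))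
    (c⁻¹ * px₀ * py₁ - qx₁ * qy₀)
    (p₁ * px₁ + b * q₀ * qy₁ + b⁻¹ * qx₀ * qz₁ + py₀ * pz₀)
    (p₀ * px₁ + p₁ * px₀ + b * (q₀ * qy₀ + q₁ * qy₁) + b⁻¹ * (qx₀ * qz₀ + qx₁ * qz₁) +
      py₀ * pz₁ + py₁ * pz₀)
    (p₀ * px₀ + b * q₁ * qy₀ + b⁻¹ * qx₁ * qz₀ + py₁ * pz₁)
    (mul_ne_zero h₂ h₃) (mul_ne_zero h₁ h₄)
  refine ⟨Units.mk0 a ha, ?_⟩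
  simp only [Units.val_mk0]
  rw [← mul_right_inj' (pow_ne_zero 2 ha), mul_zero, ← h]
  field_simp
  ring

end Determinant

/-! ### Nonvanishing of the extreme coefficients -/

section Transcendental

variable {K L : Type*} [Field K] [Field L] [Algebra K L]

/-- If the coefficients of `topPart` in the monomials in `b` and `c` vanish, then some coefficient of
the element vanishes. -/
theorem topPart_coeffs_incompatible (s : Fin 14 → K) (hs : ∀ i, s i ≠ 0)
    (e₁ : s 3 * s 4 = s 7 * s 8) (e₂ : s 3 * s 1 = s 7 * s 9)
    (e₃ : s 2 * s 0 = s 11 * s 6) (e₄ : s 2 * s 5 = s 11 * s 10)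
    (e₅ : s 0 * s 4 = s 7 * s 6)
    (e₇ : s 0 * s 1 + s 5 * s 4 + s 2 * s 3 = s 7 * s 10 + s 11 * s 8) : False := by
  -- Both sides times `s 7 * s 6` equal `s 0 * s 2 * s 3 * s 4`.
  have h₁ : s 3 * s 2 = s 11 * s 8 := by
    refine mul_left_cancel₀ (mul_ne_zero (hs 7) (hs 6)) ?_
    linear_combination (-s 3 * s 2) * e₅ + s 2 * s 0 * e₁ + s 7 * s 8 * e₃
  -- In `e₇` times `s 2 * s 3`, two terms on the left cancel the right side, and the third is this
  -- product.
  refine mul_ne_zero (mul_ne_zero (hs 11) (hs 6)) (mul_ne_zero (hs 7) (hs 9)) ?_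
  linear_combination s 2 * s 3 * e₇ - s 3 * s 1 * e₃ - s 11 * s 6 * e₂ - s 3 * s 4 * e₄ -
    s 11 * s 10 * e₁ + (s 7 * s 10 - s 2 * s 3) * h₁

theorem topPart_ne_zero (s : Fin 14 → K) (hs : ∀ i, s i ≠ 0) {t : L} (ht : Transcendental K t) :
    topPart (fun i => algebraMap K L (s i)) t (t ^ 3) ≠ 0 := by
  intro h
  have ht0 : t ≠ 0 := fun h0 => ht (h0 ▸ isAlgebraic_zero)
  -- `f` evaluates at `t` to `t * topPart`. The monomials `1, b, b⁻¹c, c, bc, b⁻¹c², c²` of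
  -- `topPart` have distinct exponents 0, 1, 2, 3, 4, 5, 6 when `b = t`, `c = t ^ 3`.
  let f : K[X] := C (s 0 * s 4 - s 7 * s 6) * X + C (s 3 * s 4 - s 7 * s 8) * X ^ 2 +
    C (s 2 * s 0 - s 11 * s 6) * X ^ 3 +
    C (s 0 * s 1 + s 5 * s 4 + s 2 * s 3 - (s 7 * s 10 + s 11 * s 8)) * X ^ 4 +
    C (s 3 * s 1 - s 7 * s 9) * X ^ 5 + C (s 2 * s 5 - s 11 * s 10) * X ^ 6 +
    C (s 5 * s 1 - s 11 * s 9) * X ^ 7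
  have hf : f = 0 := by
    refine (transcendental_iff.mp ht) f ?_
    rw [← mul_zero t, ← h]
    simp only [f, topPart, alphaZero, alphaOne, betaZero, betaOne, map_add, map_sub, map_mul,
      map_pow, aeval_C, aeval_X]
    field_simp
    ring
  have hc (n : ℕ) : f.coeff n = 0 := by simp [hf]
  simp only [f, coeff_add, coeff_C_mul, coeff_X_pow, coeff_X] at hc
  refine topPart_coeffs_incompatible s hs ?_ ?_ ?_ ?_ ?_ ?_ <;> apply sub_eq_zero.mp
  · simpa using hc 2
  · simpa using hc 5
  · simpa using hc 3
  · simpa using hc 6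
  · simpa using hc 1
  · simpa using hc 4

theorem topPart_inv_ne_zero (s : Fin 14 → K) (hs : ∀ i, s i ≠ 0) {t : L}
    (ht : Transcendental K t) :
    topPart (fun i => algebraMap K L (s i)) t⁻¹ (t ^ 3) ≠ 0 := by
  intro h
  have ht0 : t ≠ 0 := fun h0 => ht (h0 ▸ isAlgebraic_zero)
  -- With `b = t⁻¹` the same monomials have exponents 0, -1, 4, 3, 2, 7, 6, again distinct; the
  -- factor `t` clears the negative one.
  let f : K[X] := C (s 0 * s 4 - s 7 * s 6) * X + C (s 3 * s 4 - s 7 * s 8) +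
    C (s 2 * s 0 - s 11 * s 6) * X ^ 5 +
    C (s 0 * s 1 + s 5 * s 4 + s 2 * s 3 - (s 7 * s 10 + s 11 * s 8)) * X ^ 4 +
    C (s 3 * s 1 - s 7 * s 9) * X ^ 3 + C (s 2 * s 5 - s 11 * s 10) * X ^ 8 +
    C (s 5 * s 1 - s 11 * s 9) * X ^ 7
  have hf : f = 0 := by
    refine (transcendental_iff.mp ht) f ?_
    rw [← mul_zero t, ← h]
    simp only [f, topPart, alphaZero, alphaOne, betaZero, betaOne, map_add, map_sub, map_mul,
      map_pow, aeval_C, aeval_X]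
    field_simp
    ring
  have hc (n : ℕ) : f.coeff n = 0 := by simp [hf]
  simp only [f, coeff_add, coeff_C_mul, coeff_X_pow, coeff_X, coeff_C] at hc
  refine topPart_coeffs_incompatible s hs ?_ ?_ ?_ ?_ ?_ ?_ <;> apply sub_eq_zero.mp
  · simpa using hc 0
  · simpa using hc 3
  · simpa using hc 5
  · simpa using hc 8
  · simpa using hc 1
  · simpa using hc 4

theorem lift_rep_eq_sum (σ : MonoidAlgebra K FoursGroup)
    (hσ : (σ.coeff.support : Set FoursGroup) = promislowSet) (a b c : Lˣ) :
    MonoidAlgebra.lift K (Matrix (Fin 4) (Fin 4) L) FoursGroup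
        ((Units.coeHom _).comp (rep a b c)) σ =
      ∑ i, algebraMap K L (σ.coeff (promislowEnum i)) •
        (rep a b c (promislowEnum i) : Matrix (Fin 4) (Fin 4) L) := by
  classical
  have hsupp : σ.coeff.support = Finset.univ.image promislowEnum := by
    rw [← Finset.coe_inj, hσ, Finset.coe_image, Finset.coe_univ, Set.image_univ,
      range_promislowEnum]
  rw [MonoidAlgebra.lift_apply, Finsupp.sum, hsupp,
    Finset.sum_image promislowEnum_injective.injOn]
  simp

end Transcendental

end FoursGroup

open FoursGroup in
theorem theorem6p1 {K : Type*} [Field K] (σ : MonoidAlgebra K FoursGroup)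
    (hσ : (σ.coeff.support : Set FoursGroup) = FoursGroup.promislowSet) :
    ¬ IsUnit σ := by
  intro hu
  have hs (i : Fin 14) : σ.coeff (promislowEnum i) ≠ 0 := by
    rw [← Finsupp.mem_support_iff, ← Finset.mem_coe, hσ, ← range_promislowEnum]
    exact Set.mem_range_self i
  obtain ⟨t, ht⟩ : ∃ t : AlgebraicClosure (RatFunc K), Transcendental K t :=
    by
    refine ⟨algebraMap (RatFunc K) _ (algebraMap K[X] (RatFunc K) X), ?_⟩
    rw [transcendental_algebraMap_iff (FaithfulSMul.algebraMap_injective _ _),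
      transcendental_algebraMap_iff (FaithfulSMul.algebraMap_injective _ _)]
    exact transcendental_X K
  have ht' : Transcendental K t⁻¹ := fun h => ht (IsAlgebraic.inv_iff.mp h)
  let b : (AlgebraicClosure (RatFunc K))ˣ := Units.mk0 t fun h0 => ht (h0 ▸ isAlgebraic_zero)
  -- Replacing `t` by `t⁻¹` covers the two points whose second coordinate is `c⁻¹`.
  have h₂ := topPart_inv_ne_zero _ hs ht'
  have h₃ := topPart_ne_zero _ hs ht'
  rw [inv_inv, inv_pow] at h₂
  rw [inv_pow] at h₃
  obtain ⟨a, ha⟩ := exists_det_sum_rep_eq_zero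
    (fun i => algebraMap K (AlgebraicClosure (RatFunc K)) (σ.coeff (promislowEnum i))) b (b ^ 3)
    (by simpa [b] using topPart_ne_zero _ hs ht) (by simpa [b] using topPart_inv_ne_zero _ hs ht)
    (by simpa [b] using h₂) (by simpa [b] using h₃)
  rw [← lift_rep_eq_sum σ hσ] at ha
  exact ((Matrix.isUnit_iff_isUnit_det _).mp (hu.map _)).ne_zero ha
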